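/- Let $M$ be a matroid of rank $n$ on the ground set $[d]=\{1,\dots,d\}$. Let $\Gamma_M\subseteq(\mathbb{C}^n)^d=\mathbb{C}^{nd}$ be its realization space, i.e. the set of tuples $\gamma=(\gamma_1,\dots,\gamma_d)$ of vectors of $\mathbb{C}^n$ such that, for every $I\subseteq[d]$, the family $(\gamma_i)_{i\in I}$ is linearly dependent if and only if $I$ is dependent in $M$; it carries the Zariski topology induced from $\mathbb{C}^{nd}$. Let $\mathcal{L}_M$ be the set of subspaces of $M$, i.e. the set of equivalence classes of circuits of $M$ of size at most $n$, where $C_1\sim C_2$ if and only if $C_1$ and $C_2$ have the same closure in $M$. For $l\in\mathcal{L}_M$ let $|l|$ be the number of elements of $[d]$ that lie in some circuit of the class $l$, and let $\operatorname{rk}(l)$ be the common rank of the circuits in $l$. If $M$ is realizable over $\mathbb{C}$, that is, $\Gamma_M\neq\emptyset$, then the naive dimension of $\Gamma_M$ is at most its (finite) dimension: $$ nd-\sum_{l\in\mathcal{L}_M}\bigl(|l|-\operatorname{rk}(l)\bigr)\bigl(n-\operatorname{rk}(l)\bigr)\ \le\ \dim\Gamma_M . $$ -/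

import Mathlib

namespace NaiveDim

/-- The affine space `ℂ^{nd}` of `n × d` complex matrices, carrying (only) the Zariski topology.
The entry in row `i` and column `j` of `γ` is `γ (i, j)`. -/
def MatSpace (n d : ℕ) : Type := Fin n × Fin d → ℂ

/-- The `j`-th column `γ_j ∈ ℂ^n` of a matrix. -/
def MatSpace.col {n d : ℕ} (γ : MatSpace n d) (j : Fin d) : Fin n → ℂ := fun i => γ (i, j)

/-- The common zero set in `ℂ^{nd}` of a set of polynomials in the entries. -/
def zeroSet {n d : ℕ} (S : Set (MvPolynomial (Fin n × Fin d) ℂ)) : Set (MatSpace n d) :=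
  {γ | ∀ f ∈ S, MvPolynomial.eval γ f = 0}

/-- The Zariski topology: closed sets are the common zero sets of sets of polynomials. -/
instance MatSpace.zariski (n d : ℕ) : TopologicalSpace (MatSpace n d) :=
  TopologicalSpace.ofClosed {Z | ∃ S, Z = zeroSet S}
    ⟨{1}, by ext γ; simp [zeroSet]⟩
    (by
      intro A hA
      refine ⟨{f | ∃ S, zeroSet S ∈ A ∧ f ∈ S}, ?_⟩
      ext γ
      constructor
      · rintro h f ⟨S, hS, hf⟩
        exact h _ hS f hf
      · intro h Z hZ
        obtain ⟨S, rfl⟩ := hA hZ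
        exact fun f hf => h f ⟨S, hZ, hf⟩)
    (by
      rintro _ ⟨S, rfl⟩ _ ⟨T, rfl⟩
      refine ⟨{h | ∃ f ∈ S, ∃ g ∈ T, h = f * g}, ?_⟩
      ext γ
      constructor
      · rintro (h | h) _ ⟨f, hf, g, hg, rfl⟩
        · simp [h f hf]
        · simp [h g hg]
      · intro h
        by_contra hcon
        simp only [Set.mem_union, zeroSet, Set.mem_ofPred_eq, not_or, not_forall] at hcon
        obtain ⟨⟨f, hf, hf0⟩, g, hg, hg0⟩ := hcon
        have := h _ ⟨f, hf, g, hg, rfl⟩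
        rw [map_mul] at this
        exact (mul_ne_zero hf0 hg0) this)

/-- The realization space of `M` in `ℂ^n`: the `d`-tuples of vectors of `ℂ^n` for which an indexed
subfamily is linearly dependent exactly when its index set is dependent in `M`. -/
def realizationSpace {d : ℕ} (M : Matroid (Fin d)) (n : ℕ) : Set (MatSpace n d) :=
  {γ | ∀ I : Set (Fin d), ¬ LinearIndepOn ℂ γ.col I ↔ M.Dep I}

/-- The circuits of `M` of size less than `rank M + 1`. -/
def SmallCircuit {d : ℕ} (M : Matroid (Fin d)) : Type :=
  {C : Set (Fin d) // M.IsCircuit C ∧ C.encard < M.eRank + 1}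

/-- Two small circuits are equivalent when they have the same closure. -/
def circuitSetoid {d : ℕ} (M : Matroid (Fin d)) : Setoid (SmallCircuit M) where
  r C₁ C₂ := M.closure C₁.1 = M.closure C₂.1
  iseqv := ⟨fun _ => rfl, fun h => h.symm, fun h h' => h.trans h'⟩

/-- The set `𝓛_M` of subspaces of `M`: the equivalence classes of small circuits. -/
def MSubspace {d : ℕ} (M : Matroid (Fin d)) : Type := Quotient (circuitSetoid M)

instance {d : ℕ} (M : Matroid (Fin d)) : Finite (SmallCircuit M) := Subtype.finite

instance {d : ℕ} (M : Matroid (Fin d)) : Finite (MSubspace M) := Quotient.finite _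

noncomputable instance {d : ℕ} (M : Matroid (Fin d)) : Fintype (MSubspace M) := Fintype.ofFinite _

/-- The points of a subspace: the union of the circuits in the class. -/
def MSubspace.points {d : ℕ} {M : Matroid (Fin d)} (l : MSubspace M) : Set (Fin d) :=
  {p | ∃ C : SmallCircuit M, Quotient.mk (circuitSetoid M) C = l ∧ p ∈ C.1}

/-- The rank of a subspace: the rank of any circuit in the class. -/
noncomputable def MSubspace.rank {d : ℕ} {M : Matroid (Fin d)} (l : MSubspace M) : ℕ :=
  Quotient.lift (s := circuitSetoid M) (fun C : SmallCircuit M => (M.eRk C.1).toNat)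
    (fun C₁ C₂ (h : M.closure C₁.1 = M.closure C₂.1) => by
      rw [← M.eRk_closure_eq C₁.1, h, M.eRk_closure_eq]) l

/-- The naive dimension `n d - ∑_{l ∈ 𝓛_M} (|l| - rk l) (n - rk l)`, where `n = rank M`;
an integer, possibly negative. -/
noncomputable def naiveDim {d : ℕ} (M : Matroid (Fin d)) : ℤ :=
  (M.eRank.toNat : ℤ) * d -
    ∑ l : MSubspace M, ((l.points.ncard : ℤ) - l.rank) * ((M.eRank.toNat : ℤ) - l.rank)

end NaiveDim

namespace NaiveDim

open MvPolynomial

theorem isClosed_iff_eq_zeroSet {n d : ℕ} {Z : Set (MatSpace n d)} :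
    IsClosed Z ↔ ∃ S, Z = zeroSet S := by
  rw [← isOpen_compl_iff]
  change Zᶜᶜ ∈ _ ↔ _
  rw [compl_compl]
  rfl

theorem isInducing_pointToPoint (n d : ℕ) :
    Topology.IsInducing (fun γ : MatSpace n d => (pointToPoint (k := ℂ) γ)) := by
  refine ⟨TopologicalSpace.ext_isClosed fun Z => ?_⟩
  rw [isClosed_iff_eq_zeroSet, isClosed_induced_iff]
  have hpre (S : Set (MvPolynomial (Fin n × Fin d) ℂ)) :
      (fun γ : MatSpace n d => (pointToPoint (k := ℂ) γ)) ⁻¹' PrimeSpectrum.zeroLocus S =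
        zeroSet S := by
    ext γ
    exact forall₂_congr fun f _ => mem_vanishingIdeal_singleton_iff _ _
  constructor
  · rintro ⟨S, rfl⟩
    exact ⟨_, PrimeSpectrum.isClosed_zeroLocus S, hpre S⟩
  · rintro ⟨T, hT, rfl⟩
    obtain ⟨S, rfl⟩ := (PrimeSpectrum.isClosed_iff_zeroLocus T).mp hT
    exact ⟨S, hpre S⟩

/-- The automorphism of a polynomial ring substituting `X i + a i` for `X i`. -/
noncomputable def translate {σ K : Type*} [CommRing K] (a : σ → K) :
    MvPolynomial σ K ≃ₐ[K] MvPolynomial σ K :=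
  AlgEquiv.ofAlgHom (aeval fun i => X i + C (a i)) (aeval fun i => X i - C (a i))
    (by ext i; simp) (by ext i; simp)

theorem comap_translate_vanishingIdeal {σ K : Type*} [Field K] (a x : σ → K) :
    (vanishingIdeal K {x}).comap (translate a : MvPolynomial σ K ≃+* MvPolynomial σ K) =
      vanishingIdeal K {x + a} := by
  ext f
  simp only [Ideal.mem_comap, mem_vanishingIdeal_singleton_iff]
  have : (aeval x).comp (translate a : MvPolynomial σ K →ₐ[K] MvPolynomial σ K) =
      aeval (x + a) := by
    ext i; simp [translate]
  rw [← this]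
  rfl

theorem height_vanishingIdeal_singleton {σ K : Type*} [Finite σ] [Field K] [IsAlgClosed K]
    (x : σ → K) : (vanishingIdeal K {x}).height = Nat.card σ := by
  have hdim : ringKrullDim (MvPolynomial σ K) = (Nat.card σ : WithBot ℕ∞) := by
    rw [MvPolynomial.ringKrullDim_of_isNoetherianRing, ringKrullDim_eq_zero_of_field, zero_add]
  have : FiniteRingKrullDim (MvPolynomial σ K) := by
    rw [finiteRingKrullDim_iff_ne_bot_and_top, hdim]
    exact ⟨by exact WithBot.natCast_ne_bot _, fun h => ENat.natCast_ne_top _ (WithBot.coe_injective h)⟩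
  obtain ⟨p, hp, hph⟩ := Ideal.exists_isMaximal_height (R := MvPolynomial σ K)
  obtain ⟨y, rfl⟩ := eq_vanishingIdeal_singleton_of_isMaximal K hp
  have h := RingEquiv.height_comap
    (translate (x - y) : MvPolynomial σ K ≃+* MvPolynomial σ K) (vanishingIdeal K {y})
  rw [comap_translate_vanishingIdeal, add_sub_cancel] at h
  rw [h]
  rw [hdim] at hph
  exact_mod_cast hph

theorem exists_zero_eval_ne_zero {σ K : Type*} [Finite σ] [Field K] [IsAlgClosed K]
    {p : Ideal (MvPolynomial σ K)} (hp : p.IsPrime) {f : MvPolynomial σ K} (hf : f ∉ p) :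
    ∃ x : σ → K, (∀ h ∈ p, eval x h = 0) ∧ eval x f ≠ 0 := by
  rw [← MvPolynomial.IsPrime.vanishingIdeal_zeroLocus (K := K) p, mem_vanishingIdeal_iff] at hf
  push Not at hf
  simpa [aeval_eq_eval] using hf

theorem topologicalKrullDim_ne_top {n d : ℕ} (Γ : Set (MatSpace n d)) :
    topologicalKrullDim Γ ≠ ⊤ := by
  have h := (topologicalKrullDim_subspace_le _ Γ).trans
    (isInducing_pointToPoint n d).topologicalKrullDim_le
  rw [PrimeSpectrum.topologicalKrullDim_eq_ringKrullDim,
    MvPolynomial.ringKrullDim_of_isNoetherianRing, ringKrullDim_eq_zero_of_field, zero_add] at h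
  intro h'
  rw [h'] at h
  exact absurd (top_le_iff.mp h) (fun h => ENat.natCast_ne_top _ (WithBot.coe_injective h))

/-- The locally closed subset `V(S) ∩ D(g)`. -/
def basicLocallyClosed {n d : ℕ} (S : Set (MvPolynomial (Fin n × Fin d) ℂ))
    (g : MvPolynomial (Fin n × Fin d) ℂ) : Set (MatSpace n d) :=
  {δ | δ ∈ zeroSet S ∧ eval δ g ≠ 0}

/-- The primes of the polynomial ring that correspond to the irreducible closed subsets of
`V(S) ∩ D(g)`. -/
def primesBetween {n d : ℕ} (S : Set (MvPolynomial (Fin n × Fin d) ℂ))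
    (g : MvPolynomial (Fin n × Fin d) ℂ) : Set (PrimeSpectrum (MvPolynomial (Fin n × Fin d) ℂ)) :=
  {p | S ⊆ p.asIdeal ∧ g ∉ p.asIdeal}

/-- The irreducible closed subset of `V(S) ∩ D(g)` cut out by a prime. -/
def irreducibleClosedOfPrime {n d : ℕ} {S : Set (MvPolynomial (Fin n × Fin d) ℂ)}
    {g : MvPolynomial (Fin n × Fin d) ℂ} (p : primesBetween S g) :
    TopologicalSpace.IrreducibleCloseds (basicLocallyClosed S g) where
  carrier := Subtype.val ⁻¹' zeroSet (p.1.asIdeal : Set _)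
  isIrreducible' := by
    constructor
    · obtain ⟨x, hx, hxg⟩ := exists_zero_eval_ne_zero p.1.2 p.2.2
      exact ⟨⟨x, fun f hf => hx f (p.2.1 hf), hxg⟩, hx⟩
    · rw [isPreirreducible_iff_isClosed_union_isClosed]
      intro Z₁ Z₂ h₁ h₂ hsub
      rw [isClosed_induced_iff] at h₁ h₂
      obtain ⟨_, h₁, rfl⟩ := h₁
      obtain ⟨_, h₂, rfl⟩ := h₂
      obtain ⟨S₁, rfl⟩ := isClosed_iff_eq_zeroSet.mp h₁
      obtain ⟨S₂, rfl⟩ := isClosed_iff_eq_zeroSet.mp h₂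
      have hnot {T : Set (MvPolynomial (Fin n × Fin d) ℂ)}
          (hT : ¬ (Subtype.val ⁻¹' zeroSet (p.1.asIdeal : Set _) : Set (basicLocallyClosed S g)) ⊆
            Subtype.val ⁻¹' zeroSet T) : ∃ f ∈ T, f ∉ p.1.asIdeal := by
        by_contra! hcon
        exact hT fun δ hδ f hf => hδ f (hcon f hf)
      by_contra! hcon
      obtain ⟨f₁, hf₁, hp₁⟩ := hnot hcon.1
      obtain ⟨f₂, hf₂, hp₂⟩ := hnot hcon.2
      obtain ⟨x, hx, hxf⟩ := exists_zero_eval_ne_zero p.1.2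
        (p.1.2.mul_notMem (p.1.2.mul_notMem hp₁ hp₂) p.2.2)
      rw [map_mul, map_mul, mul_ne_zero_iff, mul_ne_zero_iff] at hxf
      have hmem := @hsub ⟨x, fun f hf => hx f (p.2.1 hf), hxf.2⟩ hx
      exact hmem.elim (fun h => hxf.1.1 (h f₁ hf₁)) fun h => hxf.1.2 (h f₂ hf₂)
  isClosed' := (isClosed_iff_eq_zeroSet.mpr ⟨_, rfl⟩).preimage continuous_subtype_val

theorem strictAnti_irreducibleClosedOfPrime {n d : ℕ} {S : Set (MvPolynomial (Fin n × Fin d) ℂ)}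
    {g : MvPolynomial (Fin n × Fin d) ℂ} :
    StrictAnti (irreducibleClosedOfPrime (S := S) (g := g)) := by
  intro p q hpq
  have hle : p.1.asIdeal < q.1.asIdeal := hpq
  refine lt_of_le_of_ne (fun δ hδ f hf => hδ f (hle.le hf)) fun heq => ?_
  obtain ⟨f, hfq, hfp⟩ := SetLike.exists_of_lt hle
  obtain ⟨x, hx, hxf⟩ := exists_zero_eval_ne_zero p.1.2 (p.1.2.mul_notMem hfp p.2.2)
  rw [map_mul, mul_ne_zero_iff] at hxf
  have hmem : (⟨x, fun f hf => hx f (p.2.1 hf), hxf.2⟩ : basicLocallyClosed S g) ∈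
      irreducibleClosedOfPrime p := hx
  rw [← heq] at hmem
  exact hxf.1 (hmem f hfq)

theorem card_le_topologicalKrullDim_add_encard {n d : ℕ} (Γ : Set (MatSpace n d))
    (S : Set (MvPolynomial (Fin n × Fin d) ℂ)) (g : MvPolynomial (Fin n × Fin d) ℂ)
    (hΓ : basicLocallyClosed S g ⊆ Γ) (x : Fin n × Fin d → ℂ) (hx : x ∈ basicLocallyClosed S g) :
    ∃ k : ℕ, (k : WithBot ℕ∞) ≤ topologicalKrullDim Γ ∧ ((n * d : ℕ) : ℕ∞) ≤ k + S.encard := by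
  set m : Ideal (MvPolynomial (Fin n × Fin d) ℂ) := vanishingIdeal ℂ {x}
  have hSm : S ⊆ m := fun f hf => (mem_vanishingIdeal_singleton_iff _ _).mpr (hx.1 f hf)
  have hgm : g ∉ m := fun h => hx.2 ((mem_vanishingIdeal_singleton_iff _ _).mp h)
  have hker : Ideal.span S ≤ m := Ideal.span_le.mpr hSm
  have hprime : (m.map (Ideal.Quotient.mk (Ideal.span S))).IsPrime :=
    Ideal.isPrime_map_quotientMk_of_isPrime hker
  have hht := Ideal.height_le_height_add_encard_of_subset S hSm
  obtain ⟨l, hl, hlen⟩ := Ideal.exists_ltSeries_length_eq_height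
    (m.map (Ideal.Quotient.mk (Ideal.span S)))
  rw [height_vanishingIdeal_singleton, ← hlen] at hht
  refine ⟨l.length, ?_, by simpa using hht⟩
  have hmem (i) : PrimeSpectrum.comap (Ideal.Quotient.mk (Ideal.span S)) (l i) ∈
      primesBetween S g := by
    constructor
    · intro f hf
      change Ideal.Quotient.mk (Ideal.span S) f ∈ (l i).asIdeal
      rw [Ideal.Quotient.eq_zero_iff_mem.mpr (Ideal.subset_span hf)]
      exact zero_mem _
    · intro hg
      have hle : l i ≤ RelSeries.last l := l.monotone (Fin.le_last i)
      rw [hl] at hle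
      have h2 : Ideal.Quotient.mk (Ideal.span S) g ∈ m.map (Ideal.Quotient.mk (Ideal.span S)) :=
        hle hg
      rw [Ideal.mem_quotient_iff_mem hker] at h2
      exact hgm h2
  let L : LTSeries (primesBetween S g) :=
    ⟨l.length, fun i => ⟨_, hmem i⟩, fun i => by
      have hlt : l i.castSucc < l i.succ := l.step i
      have hle : (l i.castSucc).asIdeal ≤ (l i.succ).asIdeal := hlt.le
      refine lt_of_le_of_ne (a := (⟨_, hmem i.castSucc⟩ : primesBetween S g))
        (Ideal.comap_mono hle) fun heq => hlt.ne ?_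
      exact PrimeSpectrum.comap_injective_of_surjective _ Ideal.Quotient.mk_surjective
        (Subtype.ext_iff.mp heq)⟩
  calc (l.length : WithBot ℕ∞) ≤ Order.krullDim (primesBetween S g) :=
        Order.LTSeries.length_le_krullDim L
    _ = Order.krullDim (primesBetween S g)ᵒᵈ := Order.krullDim_orderDual.symm
    _ ≤ topologicalKrullDim (basicLocallyClosed S g) :=
        Order.krullDim_le_of_strictMono (fun p => irreducibleClosedOfPrime (OrderDual.ofDual p))
          strictAnti_irreducibleClosedOfPrime.dual_left
    _ ≤ topologicalKrullDim Γ := (Topology.IsEmbedding.inclusion hΓ).isInducing.topologicalKrullDim_le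

variable {n d : ℕ}

/-- The generic matrix whose columns are the generic columns indexed by `I`, completed by the
constant columns `w`. -/
noncomputable def frame {I : Set (Fin d)} {κ : Type*} (e : Fin n ≃ I ⊕ κ) (w : κ → Fin n → ℂ) :
    Matrix (Fin n) (Fin n) (MvPolynomial (Fin n × Fin d) ℂ) :=
  Matrix.of fun i j => Sum.elim (fun b => X (i, b.1)) (fun k => C (w k i)) (e j)

/-- The value at `δ` of the generic matrix `frame e w`. -/
def frameAt {I : Set (Fin d)} {κ : Type*} (e : Fin n ≃ I ⊕ κ) (w : κ → Fin n → ℂ)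
    (δ : MatSpace n d) : Matrix (Fin n) (Fin n) ℂ :=
  Matrix.of fun i j => Sum.elim (fun b => δ.col b.1) w (e j) i

/-- The numerator in Cramer's rule for the coordinate of the generic column `q` along `w k`. -/
noncomputable def frameCoord {I : Set (Fin d)} {κ : Type*} (e : Fin n ≃ I ⊕ κ)
    (w : κ → Fin n → ℂ) (q : Fin d) (k : κ) : MvPolynomial (Fin n × Fin d) ℂ :=
  ((frame e w).updateCol (e.symm (.inr k)) fun i => X (i, q)).det

section

variable {I : Set (Fin d)} {κ : Type*} (e : Fin n ≃ I ⊕ κ) (w : κ → Fin n → ℂ) (δ : MatSpace n d)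

theorem map_eval_frame : (frame e w).map (eval δ) = frameAt e w δ := by
  ext i j
  rcases h : e j with b | k
  · simpa [frame, frameAt, h, MatSpace.col] using eval_X (f := δ) _
  · simpa [frame, frameAt, h] using eval_C (f := δ) _

theorem eval_det_frame : eval δ (frame e w).det = (frameAt e w δ).det := by
  rw [RingHom.map_det, RingHom.mapMatrix_apply, map_eval_frame]

theorem eval_frameCoord (q : Fin d) (k : κ) :
    eval δ (frameCoord e w q k) =
      Matrix.cramer (frameAt e w δ) (δ.col q) (e.symm (.inr k)) := by
  rw [frameCoord, RingHom.map_det, RingHom.mapMatrix_apply, Matrix.map_updateCol, map_eval_frame,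
    Matrix.cramer_apply]
  congr 2
  ext i
  exact eval_X _

theorem col_frameAt_inl (b : I) : (frameAt e w δ).col (e.symm (.inl b)) = δ.col b := by
  ext i; simp [frameAt]

variable {e w δ}

theorem linearIndepOn_of_det_frameAt_ne_zero (h : (frameAt e w δ).det ≠ 0) :
    LinearIndepOn ℂ δ.col I := by
  have hcols : LinearIndependent ℂ (frameAt e w δ).col :=
    Matrix.linearIndependent_cols_iff_isUnit.mpr
      ((Matrix.isUnit_iff_isUnit_det _).mpr (isUnit_iff_ne_zero.mpr h))
  have hcomp := hcols.comp (fun b : I => e.symm (.inl b))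
    (e.symm.injective.comp Sum.inl_injective)
  rwa [show (frameAt e w δ).col ∘ (fun b : I => e.symm (.inl b)) = fun b : I => δ.col b from
    funext fun b => col_frameAt_inl e w δ b] at hcomp

theorem col_mem_span_of_eval_frameCoord_eq_zero (h : (frameAt e w δ).det ≠ 0) {q : Fin d}
    (hq : ∀ k, eval δ (frameCoord e w q k) = 0) : δ.col q ∈ Submodule.span ℂ (δ.col '' I) := by
  have hc := Matrix.mulVec_cramer (frameAt e w δ) (δ.col q)
  rw [← Submodule.smul_mem_iff _ h, ← hc, Matrix.mulVec_eq_sum]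
  refine Submodule.sum_mem _ fun j _ => ?_
  obtain ⟨s, rfl⟩ := e.symm.surjective j
  rcases s with b | k
  · rw [op_smul_eq_smul]
    refine Submodule.smul_mem _ _ ?_
    exact Submodule.subset_span ⟨b, b.2, (col_frameAt_inl e w δ b).symm⟩
  · rw [← eval_frameCoord, hq]
    simp

theorem eval_frameCoord_eq_zero_of_mem_span {q : Fin d}
    (hq : δ.col q ∈ Submodule.span ℂ (δ.col '' I)) (k : κ) :
    eval δ (frameCoord e w q k) = 0 := by
  rw [eval_frameCoord]
  have hle : Submodule.span ℂ (δ.col '' I) ≤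
      LinearMap.ker (LinearMap.proj (e.symm (.inr k)) ∘ₗ (frameAt e w δ).cramer) := by
    rw [Submodule.span_le]
    rintro _ ⟨b, hb, rfl⟩
    change (frameAt e w δ).cramer (δ.col b) (e.symm (.inr k)) = 0
    rw [Matrix.cramer_apply]
    have hne : e.symm (.inl ⟨b, hb⟩) ≠ e.symm (.inr k) := by simp
    refine Matrix.det_zero_of_column_eq hne fun i => ?_
    rw [Matrix.updateCol_ne hne, Matrix.updateCol_self]
    exact congrFun (col_frameAt_inl e w δ ⟨b, hb⟩) i
  exact hle hq

end

theorem exists_det_frameAt_ne_zero {γ : MatSpace n d} {I : Set (Fin d)}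
    (hI : LinearIndepOn ℂ γ.col I) :
    ∃ (e : Fin n ≃ I ⊕ Fin (n - I.ncard)) (w : Fin (n - I.ncard) → Fin n → ℂ),
      (frameAt e w γ).det ≠ 0 := by
  classical
  let b := Module.Basis.sumExtend (v := fun i : I => γ.col i) hI
  have hfin : Finite (I ⊕ Module.Basis.sumExtendIndex hI) := Module.Finite.finite_basis b
  have hfin' : Finite (Module.Basis.sumExtendIndex hI) := 
    Finite.of_injective (β := I ⊕ Module.Basis.sumExtendIndex hI) _ Sum.inr_injective
  have hcard : Nat.card (I ⊕ Module.Basis.sumExtendIndex hI) = n := by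
    rw [← Module.finrank_eq_nat_card_basis b]; simp
  have hκ : Nat.card (Module.Basis.sumExtendIndex hI) = n - I.ncard := by
    rw [Nat.card_sum, Nat.card_coe_set_eq] at hcard
    exact Nat.eq_sub_of_add_eq' hcard
  let c : Fin (n - I.ncard) ≃ Module.Basis.sumExtendIndex hI := (Finite.equivFinOfCardEq hκ).symm
  let e' : Fin n ≃ I ⊕ Module.Basis.sumExtendIndex hI := (Finite.equivFinOfCardEq hcard).symm
  refine ⟨e'.trans (Equiv.sumCongr (Equiv.refl I) c.symm), fun k => b (.inr (c k)), ?_⟩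
  have hb : LinearIndependent ℂ (b ∘ e') := b.linearIndependent.comp _ e'.injective
  have hcol : (frameAt (e'.trans (Equiv.sumCongr (Equiv.refl I) c.symm))
      (fun k => b (.inr (c k))) γ).col = b ∘ e' := by
    ext j i
    rcases h : e' j with s | s
    · have hs : b (.inl s) = γ.col s := by
        simp only [b, Module.Basis.sumExtend, Module.Basis.reindex_apply,
          Module.Basis.extend_apply_self]
        rfl
      simp [frameAt, h, hs]
    · simp [frameAt, h]
  rw [← hcol, Matrix.linearIndependent_cols_iff_isUnit, Matrix.isUnit_iff_isUnit_det] at hb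
  exact hb.ne_zero

theorem ncard_le_ncard_of_mem_span {V : Type*} [AddCommGroup V] [Module ℂ V] {v : Fin d → V}
    {A B : Set (Fin d)} (hA : LinearIndepOn ℂ v A)
    (h : ∀ a ∈ A, v a ∈ Submodule.span ℂ (v '' B)) : A.ncard ≤ B.ncard := by
  classical
  have hle : Submodule.span ℂ (v '' A) ≤ Submodule.span ℂ (v '' B) := by
    rw [Submodule.span_le]
    rintro _ ⟨a, ha, rfl⟩
    exact h a ha
  have hfin : (v '' B).Finite := B.toFinite.image v
  have : FiniteDimensional ℂ (Submodule.span ℂ (v '' B)) := FiniteDimensional.span_of_finite ℂ hfin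
  have h1 : Module.finrank ℂ (Submodule.span ℂ (v '' A)) = A.ncard := by
    have := finrank_span_eq_card (R := ℂ) (b := fun i : A => v i) hA
    rwa [← Set.image_eq_range, ← Nat.card_eq_fintype_card] at this
  have h2 : Module.finrank ℂ (Submodule.span ℂ (v '' B)) ≤ B.ncard := by
    have := finrank_range_le_card (R := ℂ) (fun i : B => v i)
    rwa [← Set.image_eq_range, ← Nat.card_eq_fintype_card] at this
  rw [← h1]
  exact (Submodule.finrank_mono hle).trans h2

variable {M : Matroid (Fin d)}

theorem MSubspace.exists_indep (l : MSubspace M) :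
    ∃ B, M.Indep B ∧ B ⊆ l.points ∧ B.ncard = l.rank ∧ l.points ⊆ M.closure B := by
  induction l using Quotient.inductionOn with
  | h C =>
    obtain ⟨e, he⟩ := C.2.1.nonempty
    have hB := C.2.1.sdiff_singleton_isBasis he
    refine ⟨C.1 \ {e}, hB.indep, fun p hp => ⟨C, rfl, hp.1⟩, ?_, ?_⟩
    · change _ = (M.eRk C.1).toNat
      rw [← hB.encard_eq_eRk]
      rfl
    · rintro p ⟨C', hC', hp⟩
      rw [hB.closure_eq_closure, ← (Quotient.exact hC' : M.closure C'.1 = M.closure C.1)]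
      exact M.mem_closure_of_mem hp C'.2.1.subset_ground

theorem SmallCircuit.rank_lt_ncard (C : SmallCircuit M) :
    MSubspace.rank (Quotient.mk (circuitSetoid M) C) < C.1.ncard := by
  obtain ⟨e, he⟩ := C.2.1.nonempty
  change (M.eRk C.1).toNat < _
  rw [← (C.2.1.sdiff_singleton_isBasis he).encard_eq_eRk]
  exact Set.ncard_sdiff_singleton_lt_of_mem he

theorem indep_iff_linearIndepOn (hE : M.E = Set.univ) {γ : MatSpace n d}
    (hγ : γ ∈ realizationSpace M n) (I : Set (Fin d)) :
    M.Indep I ↔ LinearIndepOn ℂ γ.col I := by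
  rw [← not_iff_not, hγ I, M.not_indep_iff (by simp [hE])]

theorem col_mem_span_of_mem_closure (hE : M.E = Set.univ) {γ : MatSpace n d}
    (hγ : γ ∈ realizationSpace M n) {B : Set (Fin d)} (hB : M.Indep B) {q : Fin d}
    (hq : q ∈ M.closure B) (hqB : q ∉ B) : γ.col q ∈ Submodule.span ℂ (γ.col '' B) := by
  by_contra hcon
  have hins := (linearIndepOn_insert hqB).mpr ⟨(indep_iff_linearIndepOn hE hγ B).mp hB, hcon⟩
  rw [← indep_iff_linearIndepOn hE hγ] at hins
  exact (hB.insert_dep_iff.mpr ⟨hq, hqB⟩).not_indep hins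

/-- A configuration realizes `M` once the independent sets of `M` are linearly independent and
the points of each subspace of `M` lie in the span of an independent set of the right size. -/
theorem mem_realizationSpace_of_mem_span (hE : M.E = Set.univ) (hrank : M.eRank = n)
    {B : MSubspace M → Set (Fin d)} (hBcard : ∀ l, (B l).ncard = l.rank) {δ : MatSpace n d}
    (hindep : ∀ I, M.Indep I → LinearIndepOn ℂ δ.col I)
    (hspan : ∀ l : MSubspace M, ∀ q ∈ l.points, δ.col q ∈ Submodule.span ℂ (δ.col '' B l)) :
    δ ∈ realizationSpace M n := by
  intro I
  constructor
  · intro hI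
    rw [← M.not_indep_iff (by simp [hE])]
    exact fun h => hI (hindep I h)
  · intro hI hlin
    obtain ⟨C, hCI, hC⟩ := hI.exists_isCircuit_subset
    have hlinC := hlin.mono hCI
    by_cases hsmall : C.encard < M.eRank + 1
    · let C' : SmallCircuit M := ⟨C, hC, hsmall⟩
      have hle := ncard_le_ncard_of_mem_span hlinC fun q hq =>
        hspan (Quotient.mk (circuitSetoid M) C') q ⟨C', rfl, hq⟩
      exact absurd C'.rank_lt_ncard (hle.trans_eq (hBcard _)).not_gt
    · have hle := hlinC.encard_le_toENat_rank
      rw [hrank, not_lt] at hsmall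
      have := hsmall.trans hle
      simp at this
      exact absurd this (by exact_mod_cast Nat.not_succ_le_self n)

theorem naiveDim_eq_sub_card (hrank : M.eRank = n) {B : MSubspace M → Set (Fin d)}
    (hB : ∀ l, M.Indep (B l)) (hBsub : ∀ l : MSubspace M, B l ⊆ l.points)
    (hBcard : ∀ l, (B l).ncard = l.rank) :
    naiveDim M = (n * d : ℕ) -
      (Nat.card (Σ l : MSubspace M, ↥(l.points \ B l) × Fin (n - (B l).ncard)) : ℤ) := by
  rw [naiveDim, hrank, Nat.card_sigma]
  push_cast
  congr 1
  refine Finset.sum_congr rfl fun l _ => ?_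
  have h1 : (B l).ncard ≤ n := by
    have := (hB l).encard_le_eRank
    rw [hrank, ← (B l).toFinite.cast_ncard_eq] at this
    exact_mod_cast this
  have h2 := Set.ncard_sdiff_add_ncard_of_subset (hBsub l)
  rw [Nat.card_prod, Nat.card_coe_set_eq, Nat.card_fin, ← hBcard, ← h2]
  push_cast [h1]
  simp

theorem exists_naiveDim_le (hE : M.E = Set.univ) (hrank : M.eRank = n)
    (hreal : (realizationSpace M n).Nonempty) :
    ∃ k : ℕ, (k : WithBot ℕ∞) ≤ topologicalKrullDim (realizationSpace M n) ∧
      naiveDim M ≤ k := by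
  classical
  obtain ⟨γ, hγ⟩ := hreal
  choose B hB hBsub hBcard hBcl using MSubspace.exists_indep (M := M)
  have hframe (I : {I // M.Indep I}) :=
    exists_det_frameAt_ne_zero ((indep_iff_linearIndepOn hE hγ I.1).mp I.2)
  choose e w hdet using hframe
  have : Fintype {I // M.Indep I} := Fintype.ofFinite _
  let F (t : Σ l : MSubspace M, ↥(l.points \ B l) × Fin (n - (B l).ncard)) :
      MvPolynomial (Fin n × Fin d) ℂ :=
    frameCoord (e ⟨B t.1, hB t.1⟩) (w ⟨B t.1, hB t.1⟩) t.2.1.1 t.2.2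
  let g : MvPolynomial (Fin n × Fin d) ℂ := ∏ I, (frame (e I) (w I)).det
  have hg (δ : MatSpace n d) : eval δ g ≠ 0 ↔ ∀ I, (frameAt (e I) (w I) δ).det ≠ 0 := by
    simp only [g, map_prod, Finset.prod_ne_zero_iff, Finset.mem_univ, true_imp_iff,
      eval_det_frame]
  have hsub : basicLocallyClosed (Set.range F) g ⊆ realizationSpace M n := by
    intro δ hδ
    have hδdet := (hg δ).mp hδ.2
    refine mem_realizationSpace_of_mem_span hE hrank hBcard
      (fun I hI => linearIndepOn_of_det_frameAt_ne_zero (hδdet ⟨I, hI⟩)) fun l q hq => ?_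
    by_cases hqB : q ∈ B l
    · exact Submodule.subset_span ⟨q, hqB, rfl⟩
    · exact col_mem_span_of_eval_frameCoord_eq_zero (hδdet ⟨B l, hB l⟩) fun k =>
        hδ.1 _ ⟨⟨l, ⟨q, hq, hqB⟩, k⟩, rfl⟩
  have hzero : γ ∈ zeroSet (Set.range F) := by
    rintro _ ⟨⟨l, ⟨q, hq, hqB⟩, k⟩, rfl⟩
    exact eval_frameCoord_eq_zero_of_mem_span
      (col_mem_span_of_mem_closure hE hγ (hB l) (hBcl l hq) hqB) k
  obtain ⟨k, hk, hcard⟩ := card_le_topologicalKrullDim_add_encard (realizationSpace M n)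
    (Set.range F) g hsub γ ⟨hzero, (hg γ).mpr hdet⟩
  refine ⟨k, hk, ?_⟩
  rw [naiveDim_eq_sub_card hrank hB hBsub hBcard]
  have hF : (Set.range F).ncard ≤ Nat.card
      (Σ l : MSubspace M, ↥(l.points \ B l) × Fin (n - (B l).ncard)) :=
    Finite.card_range_le F
  rw [← (Set.finite_range F).cast_ncard_eq] at hcard
  norm_cast at hcard
  omega

end NaiveDim

theorem mainTheorem3 (n d : ℕ) (M : Matroid (Fin d)) (hE : M.E = Set.univ)
    (hrank : M.eRank = n) (hreal : (NaiveDim.realizationSpace M n).Nonempty) :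
    ∃ k : ℕ, topologicalKrullDim (NaiveDim.realizationSpace M n) = (k : WithBot ℕ∞) ∧
      NaiveDim.naiveDim M ≤ (k : ℤ) := by
  obtain ⟨k, hk, hnaive⟩ := NaiveDim.exists_naiveDim_le hE hrank hreal
  have htop := NaiveDim.topologicalKrullDim_ne_top (NaiveDim.realizationSpace M n)
  generalize topologicalKrullDim (NaiveDim.realizationSpace M n) = D at hk htop
  induction D with
  | bot => exact absurd hk (by simp)
  | coe D =>
    induction D with
    | top => exact absurd rfl htop
    | coe m =>
      refine ⟨m, rfl, hnaive.trans ?_⟩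
      norm_cast at hk ⊢
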